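/- Let $(X_n)_{n\in I}$ be a countable (finite or countably infinite) family of Polish spaces, let $\nu_n$ be a Borel probability measure on $X_n$ for each $n$, and let $X=\prod_n X_n$ carry the product topology, with coordinate projections $\pi_n$. Write $\langle f,\mu\rangle=\int f\,d\mu$. For Borel functions $g_n:X_n\to\mathbb{R}_+$ put $\oplus g:=\sum_n g_n\circ\pi_n:X\to\mathbb{R}_+\cup\{+\infty\}$. Let $G(\nu)$ be the set of all functions $\oplus g$ with $g_n:X_n\to\mathbb{R}_+$ Borel and $\sum_n\langle g_n,\nu_n\rangle<+\infty$; let $B(\nu)$ be the set of Borel functions $f:X\to\mathbb{R}$ with $|f|\le\oplus g$ for some $\oplus g\in G(\nu)$; let $U(\nu)$ be the set of upper semicontinuous $f:X\to\mathbb{R}$ such that $f^+$ is bounded and $f^-\in B(\nu)$; and let $U(\nu)+G(\nu)$ be the set of pointwise sums $h+\oplus g:X\to\mathbb{R}\cup\{+\infty\}$ with $h\in U(\nu)$ and $\oplus g\in G(\nu)$. Let $\mathcal{P}(\nu)$ be the set of Borel probability measures $\mu$ on $X$ with marginals $\mu\circ\pi_n^{-1}=\nu_n$ for all $n$. For $f\in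 B(\nu)$ define $$\phi(f):=\inf\Big\{m+\sum_n\langle g_n,\nu_n\rangle : m\in\mathbb{R},\ \oplus g\in G(\nu),\ m+\oplus g\ge f\Big\}.$$ Then for every $f\in B(\nu)\cap(U(\nu)+G(\nu))$, the function $f$ is $\mu$-integrable for every $\mu\in\mathcal{P}(\nu)$, and $$\phi(f)=\max_{\mu\in\mathcal{P}(\nu)}\langle f,\mu\rangle ,$$ where the maximum is attained (in particular $\mathcal{P}(\nu)\neq\emptyset$ and $\phi(f)\in\mathbb{R}$). -/

import Mathlib

open MeasureTheory
open scoped ENNReal NNReal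

namespace CountableTransport

variable {ι : Type*} {X : ι → Type*}

/-- The sum `⊕g = ∑ₙ gₙ ∘ πₙ` of the functions `gₙ : Xₙ → ℝ₊`, with values in `ℝ₊ ∪ {+∞}`. -/
noncomputable def oplus (g : ∀ n, X n → ℝ≥0) (x : ∀ n, X n) : ℝ≥0∞ :=
  ∑' n, (g n (x n) : ℝ≥0∞)

variable [∀ n, MeasurableSpace (X n)]

/-- The total price `∑ₙ ⟨gₙ, νₙ⟩`. -/
noncomputable def price (ν : ∀ n, Measure (X n)) (g : ∀ n, X n → ℝ≥0) : ℝ≥0∞ :=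
  ∑' n, ∫⁻ y, (g n y : ℝ≥0∞) ∂(ν n)

/-- `g = (gₙ)` is a family of Borel functions `gₙ : Xₙ → ℝ₊` with `∑ₙ ⟨gₙ, νₙ⟩ < +∞`. -/
def IsAdmissible (ν : ∀ n, Measure (X n)) (g : ∀ n, X n → ℝ≥0) : Prop :=
  (∀ n, Measurable (g n)) ∧ price ν g < ∞

/-- The set `G(ν)` of all functions `⊕g` with `g` admissible. -/
def G (ν : ∀ n, Measure (X n)) : Set ((∀ n, X n) → ℝ≥0∞) :=
  {F | ∃ g : ∀ n, X n → ℝ≥0, IsAdmissible ν g ∧ F = oplus g}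

/-- The set `B(ν)` of Borel functions `f : ∏ₙ Xₙ → ℝ` with `|f| ≤ ⊕g` for some `⊕g ∈ G(ν)`. -/
def B (ν : ∀ n, Measure (X n)) : Set ((∀ n, X n) → ℝ) :=
  {f | Measurable f ∧ ∃ F ∈ G ν, ∀ x, ENNReal.ofReal |f x| ≤ F x}

/-- The set `U(ν)` of upper semicontinuous functions `f : ∏ₙ Xₙ → ℝ` such that `f⁺` is bounded
and Borel, and `f⁻ ∈ B(ν)`. -/
def U [∀ n, TopologicalSpace (X n)] (ν : ∀ n, Measure (X n)) : Set ((∀ n, X n) → ℝ) :=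
  {f | UpperSemicontinuous f ∧
    (Measurable (fun x => max (f x) 0) ∧ ∃ C : ℝ, ∀ x, max (f x) 0 ≤ C) ∧
    (fun x => max (-f x) 0) ∈ B ν}

/-- The set `U(ν) + G(ν)` of functions with values in `ℝ ∪ {+∞}`. -/
def UaddG [∀ n, TopologicalSpace (X n)] (ν : ∀ n, Measure (X n)) : Set ((∀ n, X n) → EReal) :=
  {f | ∃ h ∈ U ν, ∃ F ∈ G ν, ∀ x, f x = ((h x : ℝ) : EReal) + ((F x : ℝ≥0∞) : EReal)}

/-- The set `P(ν)` of Borel probability measures on `∏ₙ Xₙ` with marginals `νₙ`. -/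
def couplings (ν : ∀ n, Measure (X n)) : Set (Measure (∀ n, X n)) :=
  {μ | IsProbabilityMeasure μ ∧ ∀ n, μ.map (fun x => x n) = ν n}

/-- The value `φ(f) = inf {m + ∑ₙ ⟨gₙ, νₙ⟩ : m ∈ ℝ, ⊕g ∈ G(ν), m + ⊕g ≥ f}`, as an infimum in
`[-∞, +∞]`. -/
noncomputable def phi (ν : ∀ n, Measure (X n)) (f : (∀ n, X n) → ℝ) : EReal :=
  sInf {c : EReal | ∃ (m : ℝ) (g : ∀ n, X n → ℝ≥0), IsAdmissible ν g ∧
    (∀ x, ((f x : ℝ) : EReal) ≤ (m : EReal) + ((oplus g x : ℝ≥0∞) : EReal)) ∧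
    c = (m : EReal) + ((price ν g : ℝ≥0∞) : EReal)}

end CountableTransport

namespace CountableTransport

open Filter Topology
open scoped BoundedContinuousFunction CompactlySupported

/-! Weak duality holds because `⊕g` has the same integral `price ν g` under every coupling. For the
converse, the superhedging price is sublinear on the space `hedgeable ν`, so Hahn–Banach gives a
linear `l ≤ value ν` with equality at `f` (`exists_linear_le_value`). Each `X n` embeds in a compact
Polish space. On continuous functions of the product of these spaces, `l` is positive and
normalised, hence integration against a measure. Functions of one coordinate cost at most their
expectation, which forces the marginals; they in turn force the measure to live on the image of `∏ X
n`, so it comes from a coupling `μ` (`exists_coupling_of_linear_le_value`). No tightness argument is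
needed. Write `f = h + ⊕g`. Approximating `h` from above by continuous functions gives `l h ≤ ∫ h
∂μ`, and `l (⊕g) ≤ price ν g = ∫ ⊕g ∂μ`. Adding, `value ν f = l f ≤ ∫ f ∂μ`, so `μ` is optimal. -/

/-- As `b ≥ 0`, truncating `a - m` at zero loses nothing. Superhedging can thus be handled in `ℝ≥0∞`
instead of `EReal`. -/
theorem ofReal_sub_le_iff (a m : ℝ) (b : ℝ≥0∞) :
    ENNReal.ofReal (a - m) ≤ b ↔ (a : EReal) ≤ (m : EReal) + (b : EReal) := by
  induction b with
  | top => simp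
  | coe b =>
    have : ((b : ℝ≥0∞) : EReal) = ((b : ℝ) : EReal) := rfl
    rw [this, ← EReal.coe_add, EReal.coe_le_coe_iff, ENNReal.ofReal, ENNReal.coe_le_coe,
      Real.toNNReal_le_iff_le_coe]
    constructor <;> intro h <;> linarith

/-! ### Algebra of superhedges and their costs. -/

section Oplus

variable {ι : Type*} {X : ι → Type*}

theorem oplus_add (g g' : ∀ n, X n → ℝ≥0) (x : ∀ n, X n) :
    oplus (g + g') x = oplus g x + oplus g' x := by
  simp [oplus, ENNReal.tsum_add]

theorem oplus_smul (c : ℝ≥0) (g : ∀ n, X n → ℝ≥0) (x : ∀ n, X n) :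
    oplus (c • g) x = c * oplus g x := by
  simp [oplus, ENNReal.tsum_mul_left]

end Oplus

section Superhedging

variable {ι : Type*} {X : ι → Type*} [∀ n, MeasurableSpace (X n)]
  {ν : ∀ n, Measure (X n)} {f f' : (∀ n, X n) → ℝ} {m m' : ℝ} {g g' : ∀ n, X n → ℝ≥0}

/-- `m + ⊕g` is an admissible superhedge of `f`. -/
def Superhedges (ν : ∀ n, Measure (X n)) (f : (∀ n, X n) → ℝ) (m : ℝ)
    (g : ∀ n, X n → ℝ≥0) : Prop :=
  IsAdmissible ν g ∧ ∀ x, ENNReal.ofReal (f x - m) ≤ oplus g x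

/-- The cost of the superhedge `m + ⊕g`. -/
noncomputable def cost (ν : ∀ n, Measure (X n)) (m : ℝ) (g : ∀ n, X n → ℝ≥0) : ℝ :=
  m + (price ν g).toReal

theorem price_add (hg : ∀ n, Measurable (g n)) :
    price ν (g + g') = price ν g + price ν g' := by
  simp only [price, Pi.add_apply, ENNReal.coe_add]
  rw [← ENNReal.tsum_add]
  exact tsum_congr fun n => lintegral_add_left (hg n).coe_nnreal_ennreal _

theorem price_smul (c : ℝ≥0) : price ν (c • g) = c * price ν g := by
  simp only [price, Pi.smul_apply, smul_eq_mul, ENNReal.coe_mul]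
  rw [← ENNReal.tsum_mul_left]
  exact tsum_congr fun n => lintegral_const_mul' _ _ ENNReal.coe_ne_top

theorem IsAdmissible.add (hg : IsAdmissible ν g) (hg' : IsAdmissible ν g') :
    IsAdmissible ν (g + g') :=
  ⟨fun n => (hg.1 n).add (hg'.1 n), by
    rw [price_add hg.1]; exact ENNReal.add_lt_top.2 ⟨hg.2, hg'.2⟩⟩

theorem IsAdmissible.smul (c : ℝ≥0) (hg : IsAdmissible ν g) : IsAdmissible ν (c • g) :=
  ⟨fun n => (hg.1 n).const_smul c, by
    rw [price_smul]; exact ENNReal.mul_lt_top ENNReal.coe_lt_top hg.2⟩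

theorem isAdmissible_zero : IsAdmissible ν (0 : ∀ n, X n → ℝ≥0) :=
  ⟨fun _ => measurable_const, by simp [price]⟩

theorem Superhedges.add (h : Superhedges ν f m g) (h' : Superhedges ν f' m' g') :
    Superhedges ν (f + f') (m + m') (g + g') :=
  ⟨h.1.add h'.1, fun x => by
    rw [oplus_add, Pi.add_apply, add_sub_add_comm]
    exact ENNReal.ofReal_add_le.trans (add_le_add (h.2 x) (h'.2 x))⟩

theorem Superhedges.smul (c : ℝ≥0) (h : Superhedges ν f m g) :
    Superhedges ν ((c : ℝ) • f) (c * m) (c • g) :=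
  ⟨h.1.smul c, fun x => by
    rw [oplus_smul, Pi.smul_apply, smul_eq_mul, ← mul_sub, ENNReal.ofReal_mul c.coe_nonneg,
      ENNReal.ofReal_coe_nnreal]
    gcongr
    exact h.2 x⟩

theorem superhedges_of_le (hf : ∀ x, f x ≤ m) : Superhedges ν f m 0 :=
  ⟨isAdmissible_zero, fun x => by
    rw [ENNReal.ofReal_of_nonpos (by linarith [hf x])]; exact zero_le⟩

theorem cost_add (hg : IsAdmissible ν g) (hg' : IsAdmissible ν g') :
    cost ν (m + m') (g + g') = cost ν m g + cost ν m' g' := by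
  rw [cost, cost, cost, price_add hg.1, ENNReal.toReal_add hg.2.ne hg'.2.ne]
  ring

theorem cost_smul (c : ℝ≥0) : cost ν (c * m) (c • g) = c * cost ν m g := by
  rw [cost, cost, price_smul, ENNReal.toReal_mul, ENNReal.coe_toReal]
  ring

theorem cost_zero (m : ℝ) : cost ν m 0 = m := by simp [cost, price]

/-! ### Integration against couplings and weak duality. -/

section Countable

variable [Countable ι] {μ : Measure (∀ n, X n)}

theorem measurable_oplus (hg : ∀ n, Measurable (g n)) : Measurable (oplus g) :=
  Measurable.tsum fun n => ((hg n).comp (measurable_pi_apply n)).coe_nnreal_ennreal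

theorem lintegral_oplus (hμ : μ ∈ couplings ν) (hg : ∀ n, Measurable (g n)) :
    ∫⁻ x, oplus g x ∂μ = price ν g := by
  refine (lintegral_tsum fun n =>
    ((hg n).comp (measurable_pi_apply n)).coe_nnreal_ennreal.aemeasurable).trans ?_
  refine tsum_congr fun n => ?_
  simp only [Function.comp_apply]
  rw [← hμ.2 n, lintegral_map (hg n).coe_nnreal_ennreal (measurable_pi_apply n)]

theorem integrable_oplus (hμ : μ ∈ couplings ν) (hg : IsAdmissible ν g) :
    Integrable (fun x => (oplus g x).toReal) μ :=
  integrable_toReal_of_lintegral_ne_top (measurable_oplus hg.1).aemeasurable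
    (by rw [lintegral_oplus hμ hg.1]; exact hg.2.ne)

theorem ae_oplus_lt_top (hμ : μ ∈ couplings ν) (hg : IsAdmissible ν g) :
    ∀ᵐ x ∂μ, oplus g x < ∞ :=
  ae_lt_top (measurable_oplus hg.1) (by rw [lintegral_oplus hμ hg.1]; exact hg.2.ne)

theorem integral_oplus (hμ : μ ∈ couplings ν) (hg : IsAdmissible ν g) :
    ∫ x, (oplus g x).toReal ∂μ = (price ν g).toReal := by
  rw [integral_toReal (measurable_oplus hg.1).aemeasurable (ae_oplus_lt_top hμ hg),
    lintegral_oplus hμ hg.1]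

theorem Superhedges.integral_le (hμ : μ ∈ couplings ν) (hf : Integrable f μ)
    (h : Superhedges ν f m g) : ∫ x, f x ∂μ ≤ cost ν m g := by
  have := hμ.1
  have key : ∫ x, f x ∂μ ≤ ∫ x, (m + (oplus g x).toReal) ∂μ := by
    refine integral_mono_ae hf ((integrable_const m).add (integrable_oplus hμ h.1)) ?_
    filter_upwards [ae_oplus_lt_top hμ h.1] with x hx
    have := (ENNReal.ofReal_le_iff_le_toReal hx.ne).1 (h.2 x)
    show f x ≤ m + (oplus g x).toReal
    linarith
  rwa [integral_add (integrable_const m) (integrable_oplus hμ h.1), integral_oplus hμ h.1,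
    integral_const, probReal_univ, one_smul] at key

theorem integrable_of_mem_B (hμ : μ ∈ couplings ν) (hf : f ∈ B ν) : Integrable f μ := by
  obtain ⟨hm, F, ⟨g, hg, rfl⟩, hF⟩ := hf
  refine (integrable_oplus hμ hg).mono' hm.aestronglyMeasurable ?_
  filter_upwards [ae_oplus_lt_top hμ hg] with x hx
  exact (ENNReal.ofReal_le_iff_le_toReal hx.ne).1 (hF x)

end Countable

/-- One coupling is enough to keep the price from being `-∞`; see `bddBelow_costs`. -/
theorem infinitePi_mem_couplings [∀ n, IsProbabilityMeasure (ν n)] :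
    Measure.infinitePi ν ∈ couplings ν :=
  ⟨inferInstance, fun n => Measure.infinitePi_map_eval ν n⟩

/-! ### The superhedging price as a sublinear functional. -/

variable (ν) in
/-- The functions which can be superhedged from above and from below. -/
def hedgeable : Submodule ℝ ((∀ n, X n) → ℝ) where
  carrier := {f | (∃ m g, Superhedges ν f m g) ∧ ∃ m g, Superhedges ν (-f) m g}
  zero_mem' := ⟨⟨0, 0, superhedges_of_le fun _ => le_rfl⟩,
    ⟨0, 0, superhedges_of_le fun _ => by simp⟩⟩
  add_mem' := by
    rintro a b ⟨⟨m, g, h⟩, ⟨m', g', h'⟩⟩ ⟨⟨n, k, l⟩, ⟨n', k', l'⟩⟩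
    exact ⟨⟨_, _, h.add l⟩, ⟨_, _, by rw [neg_add]; exact h'.add l'⟩⟩
  smul_mem' := by
    rintro c a ⟨⟨m, g, h⟩, ⟨m', g', h'⟩⟩
    rcases le_total 0 c with hc | hc
    · lift c to ℝ≥0 using hc
      exact ⟨⟨_, _, h.smul c⟩, ⟨_, _, by rw [← smul_neg]; exact h'.smul c⟩⟩
    · obtain ⟨d, rfl⟩ : ∃ d, c = -d := ⟨-c, by simp⟩
      lift d to ℝ≥0 using by linarith
      exact ⟨⟨_, _, by rw [neg_smul, ← smul_neg]; exact h'.smul d⟩,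
        ⟨_, _, by rw [neg_smul, neg_neg]; exact h.smul d⟩⟩

variable (ν) in
/-- The costs of all superhedges of `f`. -/
def costs (f : (∀ n, X n) → ℝ) : Set ℝ := {c | ∃ m g, Superhedges ν f m g ∧ c = cost ν m g}

variable (ν) in
/-- The real-valued superhedging price. -/
noncomputable def value (f : (∀ n, X n) → ℝ) : ℝ := sInf (costs ν f)

theorem costs_nonempty (hf : f ∈ hedgeable ν) : (costs ν f).Nonempty := by
  obtain ⟨⟨m, g, h⟩, -⟩ := hf
  exact ⟨_, m, g, h, rfl⟩

/-- This direction suffices, since `integral_le_phi` closes the circle at the optimal coupling. -/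
theorem phi_le_value (hf : f ∈ hedgeable ν) : phi ν f ≤ (value ν f : EReal) := by
  refine EReal.le_of_forall_lt_iff_le.1 fun z hz => ?_
  obtain ⟨_, ⟨m, g, h, rfl⟩, hlt⟩ :=
    exists_lt_of_csInf_lt (costs_nonempty hf) (EReal.coe_lt_coe_iff.1 hz)
  have hle : phi ν f ≤ (m : EReal) + (price ν g : EReal) :=
    sInf_le ⟨m, g, h.1, fun x => (ofReal_sub_le_iff _ _ _).1 (h.2 x), rfl⟩
  refine hle.trans ?_
  rw [← EReal.coe_ennreal_toReal h.1.2.ne, ← EReal.coe_add]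
  exact EReal.coe_le_coe_iff.2 hlt.le

theorem integral_le_phi [Countable ι] {μ : Measure (∀ n, X n)} (hμ : μ ∈ couplings ν)
    (hf : Integrable f μ) : ((∫ x, f x ∂μ : ℝ) : EReal) ≤ phi ν f := by
  refine le_sInf ?_
  rintro _ ⟨m, g, hg, h, rfl⟩
  rw [← EReal.coe_ennreal_toReal hg.2.ne, ← EReal.coe_add]
  exact EReal.coe_le_coe_iff.2
    (Superhedges.integral_le hμ hf ⟨hg, fun x => (ofReal_sub_le_iff _ _ _).2 (h x)⟩)

variable [Countable ι] [∀ n, IsProbabilityMeasure (ν n)]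

/-- A fixed superhedge of `-f` plus any superhedge of `f` superhedges `0`, so weak duality against
the product measure makes the total cost nonnegative. -/
theorem bddBelow_costs (hf : f ∈ hedgeable ν) : BddBelow (costs ν f) := by
  obtain ⟨-, m, g, h⟩ := hf
  refine ⟨-cost ν m g, ?_⟩
  rintro _ ⟨m', g', h', rfl⟩
  have h0 := h.add h'
  rw [neg_add_cancel] at h0
  have := h0.integral_le infinitePi_mem_couplings (integrable_zero _ _ _)
  rw [cost_add h.1 h'.1] at this
  simp only [Pi.zero_apply, integral_zero] at this
  linarith

theorem value_le (hf : f ∈ hedgeable ν) (h : Superhedges ν f m g) : value ν f ≤ cost ν m g :=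
  csInf_le (bddBelow_costs hf) ⟨m, g, h, rfl⟩

theorem value_add_le (hf : f ∈ hedgeable ν) (hf' : f' ∈ hedgeable ν) :
    value ν (f + f') ≤ value ν f + value ν f' := by
  refine le_of_forall_pos_le_add fun ε hε => ?_
  obtain ⟨_, ⟨m, g, h, rfl⟩, hlt⟩ :=
    exists_lt_of_csInf_lt (costs_nonempty hf) (lt_add_of_pos_right (value ν f) (half_pos hε))
  obtain ⟨_, ⟨m', g', h', rfl⟩, hlt'⟩ :=
    exists_lt_of_csInf_lt (costs_nonempty hf') (lt_add_of_pos_right (value ν f') (half_pos hε))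
  have := value_le (add_mem hf hf') (h.add h')
  rw [cost_add h.1 h'.1] at this
  linarith

theorem value_smul_le (c : ℝ≥0) (hf : f ∈ hedgeable ν) :
    value ν ((c : ℝ) • f) ≤ c * value ν f := by
  refine le_of_forall_pos_le_add fun ε hε => ?_
  -- The tolerance `ε / (c + 1)` also covers `c = 0`.
  obtain ⟨_, ⟨m, g, h, rfl⟩, hlt⟩ := exists_lt_of_csInf_lt (costs_nonempty hf)
    (lt_add_of_pos_right (value ν f) (div_pos hε (c.coe_nonneg.trans_lt (lt_add_one (c : ℝ)))))
  have h1 := value_le ((hedgeable ν).smul_mem _ hf) (h.smul c)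
  rw [cost_smul] at h1
  have hc : (0 : ℝ) ≤ c := c.2
  have h2 := mul_le_mul_of_nonneg_left hlt.le hc
  have h3 : (c : ℝ) * (ε / (c + 1)) ≤ ε := by
    rw [mul_div_assoc', div_le_iff₀ (by positivity)]
    nlinarith
  have h4 : (c : ℝ) * sInf (costs ν f) = c * value ν f := rfl
  linarith

theorem value_smul {c : ℝ} (hc : 0 < c) (hf : f ∈ hedgeable ν) :
    value ν (c • f) = c * value ν f := by
  refine le_antisymm (value_smul_le ⟨c, hc.le⟩ hf) ?_
  have : value ν (c⁻¹ • c • f) ≤ c⁻¹ * value ν (c • f) :=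
    value_smul_le ⟨c⁻¹, by positivity⟩ ((hedgeable ν).smul_mem c hf)
  rw [smul_smul, inv_mul_cancel₀ hc.ne', one_smul] at this
  calc c * value ν f ≤ c * (c⁻¹ * value ν (c • f)) := by gcongr
    _ = _ := by field_simp

theorem value_zero : value ν (0 : (∀ n, X n) → ℝ) = 0 := by
  have := value_smul (ν := ν) (c := 2) two_pos (zero_mem _)
  rw [smul_zero] at this
  linarith

theorem neg_value_neg_le (hf : f ∈ hedgeable ν) : -value ν (-f) ≤ value ν f := by
  have := value_add_le hf (neg_mem hf)
  rw [add_neg_cancel, value_zero] at this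
  linarith

/-- A linear functional which is dominated by the superhedging price and touches it at `f`. -/
theorem exists_linear_le_value (hf : f ∈ hedgeable ν) :
    ∃ l : hedgeable ν →ₗ[ℝ] ℝ, l ⟨f, hf⟩ = value ν f ∧ ∀ u, l u ≤ value ν u := by
  -- Prescribing a value on the line through `f` requires `f ≠ 0`; for `f = 0` the zero subspace is
  -- extended instead.
  by_cases h0 : (⟨f, hf⟩ : hedgeable ν) = 0
  · obtain ⟨l, -, hl⟩ := exists_extension_of_le_sublinear
      (⊥ : hedgeable ν →ₗ.[ℝ] ℝ) (fun u => value ν (u : (∀ n, X n) → ℝ))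
      (fun c hc u => value_smul hc u.2) (fun u v => value_add_le u.2 v.2)
      (fun u => by
        rcases u with ⟨u, hu⟩
        obtain rfl : u = 0 := (Submodule.mem_bot ℝ).1 hu
        exact ((LinearPMap.map_zero _).trans value_zero.symm).le)
    refine ⟨l, ?_, hl⟩
    have : f = 0 := congrArg Subtype.val h0
    rw [h0, map_zero, this, value_zero]
  · obtain ⟨l, hl0, hl⟩ := exists_extension_of_le_sublinear
      (LinearPMap.mkSpanSingleton (σ := RingHom.id ℝ) (⟨f, hf⟩ : hedgeable ν) (value ν f) h0)
      (fun u => value ν (u : (∀ n, X n) → ℝ))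
      (fun c hc u => value_smul hc u.2) (fun u v => value_add_le u.2 v.2)
      (fun u => by
        rcases u with ⟨u, hu⟩
        obtain ⟨c, rfl⟩ := Submodule.mem_span_singleton.1 hu
        rw [LinearPMap.mkSpanSingleton'_apply]
        show c * value ν f ≤ value ν (c • f)
        rcases lt_trichotomy c 0 with hc | rfl | hc
        -- For `c < 0`, homogeneity applies to `-(c • f) = (-c) • f`, and subadditivity transfers
        -- the bound to `c • f`.
        · have h1 := neg_value_neg_le ((hedgeable ν).smul_mem c hf)
          rw [← neg_smul, value_smul (neg_pos.2 hc) hf] at h1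
          linarith
        · simp [value_zero]
        · exact (value_smul hc hf).ge)
    refine ⟨l, ?_, hl⟩
    have := hl0 ⟨⟨f, hf⟩, Submodule.mem_span_singleton_self _⟩
    rwa [LinearPMap.mkSpanSingleton_apply] at this

end Superhedging

/-! ### Representation, approximation and pull-back of measures. -/

/-- Riesz–Markov–Kakutani on a compact space, for functionals on all continuous functions. -/
theorem exists_measure_integral_eq {Y : Type*} [TopologicalSpace Y] [T2Space Y] [CompactSpace Y]
    [MeasurableSpace Y] [BorelSpace Y] (L : C(Y, ℝ) →ₗ[ℝ] ℝ)
    (hL : ∀ u : C(Y, ℝ), (∀ y, 0 ≤ u y) → 0 ≤ L u) :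
    ∃ μ : Measure Y, IsFiniteMeasure μ ∧ ∀ u : C(Y, ℝ), ∫ y, u y ∂μ = L u := by
  let T : C_c(Y, ℝ) →ₗ[ℝ] ℝ :=
    { toFun u := L u
      map_add' u v := L.map_add u v
      map_smul' c u := L.map_smul c u }
  let Λ : C_c(Y, ℝ) →ₚ[ℝ] ℝ := PositiveLinearMap.mk₀ T fun u hu => hL u fun y => hu y
  refine ⟨RealRMK.rieszMeasure Λ, inferInstance, fun u => ?_⟩
  exact RealRMK.integral_rieszMeasure Λ (CompactlySupportedContinuousMap.continuousMapEquiv u)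

/-- A bounded above, upper semicontinuous function on a subspace of a metric space is the limit of
continuous functions on the whole space that dominate it. -/
theorem exists_continuous_approx_of_upperSemicontinuous {X Y : Type*} [TopologicalSpace X]
    [Nonempty X] [PseudoMetricSpace Y] {e : X → Y} (he : IsInducing e) {h : X → ℝ}
    (hh : UpperSemicontinuous h) {C : ℝ} (hC : ∀ x, h x ≤ C) :
    ∃ H : ℕ → C(Y, ℝ), (∀ k x, h x ≤ H k (e x)) ∧ (∀ k y, H k y ≤ C) ∧
      ∀ x, Tendsto (fun k => H k (e x)) atTop (𝓝 (h x)) := by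
  -- The Lipschitz sup-convolution of `h`, transported along `e`: a supremum of `k`-Lipschitz
  -- functions of `y`.
  let H : ℕ → Y → ℝ := fun k y => ⨆ x, (h x - k * dist y (e x))
  have hb (k : ℕ) (y : Y) (x : X) : h x - k * dist y (e x) ≤ C :=
    (sub_le_self _ (by positivity)).trans (hC x)
  have hbdd (k : ℕ) (y : Y) : BddAbove (Set.range fun x => h x - k * dist y (e x)) :=
    ⟨C, by rintro _ ⟨x, rfl⟩; exact hb k y x⟩
  have hlip (k : ℕ) : LipschitzWith k (H k) := by
    refine LipschitzWith.of_le_add_mul _ fun y z => ciSup_le fun x => ?_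
    have h1 : h x - k * dist z (e x) ≤ H k z := le_ciSup (hbdd k z) x
    have h2 := mul_le_mul_of_nonneg_left (dist_triangle_left z (e x) y) k.cast_nonneg (α := ℝ)
    simp only [NNReal.coe_natCast]
    linarith
  have hle (k : ℕ) (x : X) : h x ≤ H k (e x) := by
    have := le_ciSup (hbdd k (e x)) x
    simpa using this
  refine ⟨fun k => ⟨H k, (hlip k).continuous⟩, hle, fun k y => ciSup_le (hb k y), fun x => ?_⟩
  rw [Metric.tendsto_atTop]
  intro ε hε
  have hnhds : {x' | h x' < h x + ε / 2} ∈ 𝓝 x := hh x _ (by linarith)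
  rw [he.nhds_eq_comap, mem_comap] at hnhds
  obtain ⟨t, ht, hts⟩ := hnhds
  obtain ⟨δ, hδ, hball⟩ := Metric.mem_nhds_iff.1 ht
  obtain ⟨N, hN⟩ := exists_nat_ge ((C - h x) / δ)
  refine ⟨N, fun k hk => ?_⟩
  -- For such `k`, points at distance at least `δ` contribute at most `C - k * δ ≤ h x`; nearer ones
  -- are controlled by semicontinuity.
  have hkδ : C - h x ≤ k * δ := by
    rw [← div_le_iff₀ hδ]
    exact hN.trans (by exact_mod_cast hk)
  have hup : H k (e x) ≤ h x + ε / 2 := by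
    refine ciSup_le fun x' => ?_
    rcases lt_or_ge (dist (e x') (e x)) δ with hd | hd
    · have : h x' < h x + ε / 2 := hts (hball hd)
      have h0 : (0 : ℝ) ≤ k * dist (e x) (e x') := by positivity
      linarith
    · rw [dist_comm] at hd
      have h0 := mul_le_mul_of_nonneg_left hd k.cast_nonneg (α := ℝ)
      linarith [hC x']
  show |H k (e x) - h x| < ε
  rw [abs_lt]
  constructor <;> linarith [hle k x]

/-- A measure on a product of larger spaces whose marginals come from `ν` comes from a coupling. -/
theorem exists_coupling_map_eq {ι : Type*} [Countable ι] {X Y : ι → Type*}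
    [∀ n, MeasurableSpace (X n)] [∀ n, TopologicalSpace (X n)] [∀ n, PolishSpace (X n)]
    [∀ n, BorelSpace (X n)] [∀ n, MeasurableSpace (Y n)] [∀ n, TopologicalSpace (Y n)]
    [∀ n, PolishSpace (Y n)] [∀ n, BorelSpace (Y n)] {ν : ∀ n, Measure (X n)}
    {e : ∀ n, X n → Y n} (he : ∀ n, IsEmbedding (e n)) {ρ : Measure (∀ n, Y n)}
    (hρ1 : ρ Set.univ = 1) (hmarg : ∀ n, ρ.map (fun y => y n) = (ν n).map (e n)) :
    ∃ μ ∈ couplings ν, μ.map (Pi.map e) = ρ := by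
  have hemb : IsEmbedding (Pi.map e) := IsEmbedding.piMap he
  -- Lusin–Souslin: a continuous injection between Polish spaces maps Borel sets to Borel sets.
  have hE : MeasurableEmbedding (Pi.map e) :=
    hemb.continuous.measurableEmbedding hemb.injective
  have hen (n : ι) : MeasurableEmbedding (e n) :=
    (he n).continuous.measurableEmbedding (he n).injective
  -- Each marginal is carried by the range of `e n`. Countability of `ι` allows all coordinates to
  -- be treated on one set of full measure.
  have hrange : ∀ᵐ y ∂ρ, y ∈ Set.range (Pi.map e) := by
    have h1 : ∀ n, ∀ᵐ y ∂ρ, y n ∈ Set.range (e n) := fun n => by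
      refine ae_of_ae_map (f := fun y : ∀ n, Y n => y n) (measurable_pi_apply n).aemeasurable
        (p := fun z => z ∈ Set.range (e n)) ?_
      rw [hmarg n]
      exact ae_map_mem_range (e n) (hen n).measurableSet_range (ν n)
    filter_upwards [ae_all_iff.2 h1] with y hy
    choose x hx using hy
    exact ⟨x, funext hx⟩
  have hmap : (ρ.comap (Pi.map e)).map (Pi.map e) = ρ := by
    rw [hE.map_comap, Measure.restrict_eq_self_of_ae_mem hrange]
  refine ⟨ρ.comap (Pi.map e), ⟨⟨?_⟩, fun n => ?_⟩, hmap⟩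
  · rw [← hρ1]
    nth_rewrite 2 [← hmap]
    rw [hE.map_apply, Set.preimage_univ]
  · rw [← (hen n).comap_map (ν n), ← hmarg n, ← (hen n).comap_map (Measure.map _ _)]
    congr 1
    nth_rewrite 2 [← hmap]
    rw [Measure.map_map (hen n).measurable (measurable_pi_apply n),
      Measure.map_map (measurable_pi_apply n) hE.measurable]
    rfl
-- From dominated linear functionals to couplings.
section Coupling

variable {ι : Type*} {X : ι → Type*} [∀ n, MeasurableSpace (X n)] {ν : ∀ n, Measure (X n)}

theorem mem_hedgeable_of_bounded {f : (∀ n, X n) → ℝ} {C : ℝ} (hf : ∀ x, |f x| ≤ C) :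
    f ∈ hedgeable ν :=
  ⟨⟨C, 0, superhedges_of_le fun x => (le_abs_self _).trans (hf x)⟩,
    ⟨C, 0, superhedges_of_le fun x => (neg_le_abs _).trans (hf x)⟩⟩

theorem comp_mem_hedgeable {Z : Type*} [TopologicalSpace Z] [CompactSpace Z] (u : C(Z, ℝ))
    (e : (∀ n, X n) → Z) : (fun x => u (e x)) ∈ hedgeable ν :=
  mem_hedgeable_of_bounded fun x => u.norm_coe_le_norm (e x)

theorem mem_hedgeable_of_mem_B {f : (∀ n, X n) → ℝ} (hf : f ∈ B ν) : f ∈ hedgeable ν := by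
  obtain ⟨-, F, ⟨g, hg, rfl⟩, hF⟩ := hf
  refine ⟨⟨0, g, hg, fun x => ?_⟩, 0, g, hg, fun x => ?_⟩ <;>
    refine (ENNReal.ofReal_le_ofReal ?_).trans (hF x) <;> rw [sub_zero]
  · exact le_abs_self _
  · exact neg_le_abs _

variable [Countable ι] [∀ n, IsProbabilityMeasure (ν n)]

/-- A bounded function of a single coordinate costs at most its expectation. -/
theorem value_eval_le (n : ι) {v : X n → ℝ} (hv : Measurable v) {C : ℝ} (hC : ∀ y, |v y| ≤ C) :
    value ν (fun x => v (x n)) ≤ ∫ y, v y ∂(ν n) := by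
  classical
  have hint : Integrable v (ν n) :=
    Integrable.of_bound hv.aestronglyMeasurable C (Eventually.of_forall hC)
  have hnn (y : X n) : 0 ≤ v y + C := by linarith [neg_abs_le (v y), hC y]
  -- Shifting by `C` makes the payoff nonnegative; the constant `-C` in the superhedge compensates.
  let g : ∀ k, X k → ℝ≥0 := Pi.single n fun y => (v y + C).toNNReal
  have hg0 (k : ι) (hk : k ≠ n) : g k = 0 := Pi.single_eq_of_ne hk _
  have hgn : g n = fun y => (v y + C).toNNReal := Pi.single_eq_same n _
  have hprice : price ν g = ENNReal.ofReal (∫ y, (v y + C) ∂(ν n)) := by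
    rw [price, tsum_eq_single n fun k hk => by simp [hg0 k hk], hgn]
    exact (ofReal_integral_eq_lintegral_ofReal (hint.add (integrable_const C))
      (Eventually.of_forall hnn)).symm
  have hadm : IsAdmissible ν g := by
    refine ⟨fun k => ?_, by rw [hprice]; exact ENNReal.ofReal_lt_top⟩
    rcases eq_or_ne k n with rfl | hk
    · rw [hgn]; exact (hv.add_const C).real_toNNReal
    · rw [hg0 k hk]; exact measurable_const
  have hs : Superhedges ν (fun x => v (x n)) (-C) g := by
    refine ⟨hadm, fun x => ?_⟩
    rw [oplus, tsum_eq_single n fun k hk => by simp [hg0 k hk], hgn, sub_neg_eq_add]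
    rfl
  refine (value_le (mem_hedgeable_of_bounded fun x => hC (x n)) hs).trans_eq ?_
  rw [cost, hprice, ENNReal.toReal_ofReal (integral_nonneg hnn),
    integral_add hint (integrable_const C), integral_const, probReal_univ, one_smul]
  ring

variable [∀ n, TopologicalSpace (X n)] [∀ n, PolishSpace (X n)] [∀ n, BorelSpace (X n)]
  {Y : ι → Type*} [∀ n, TopologicalSpace (Y n)] [∀ n, CompactSpace (Y n)]
  [∀ n, PolishSpace (Y n)]

/-- A linear functional dominated by the superhedging price is integration against a coupling, on
the functions that extend continuously to a compactification. -/
theorem exists_coupling_of_linear_le_value {e : ∀ n, X n → Y n} (he : ∀ n, IsEmbedding (e n))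
    (l : hedgeable ν →ₗ[ℝ] ℝ) (hl : ∀ u, l u ≤ value ν u) :
    ∃ μ ∈ couplings ν, ∀ u : C(∀ n, Y n, ℝ),
      ∫ x, u (Pi.map e x) ∂μ = l ⟨fun x => u (Pi.map e x), comp_mem_hedgeable u _⟩ := by
  let _ : ∀ n, MeasurableSpace (Y n) := fun n => borel (Y n)
  have : ∀ n, BorelSpace (Y n) := fun n => ⟨rfl⟩
  have hemb : IsEmbedding (Pi.map e) := IsEmbedding.piMap he
  have hE : MeasurableEmbedding (Pi.map e) :=
    hemb.continuous.measurableEmbedding hemb.injective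
  have hen (n : ι) : MeasurableEmbedding (e n) :=
    (he n).continuous.measurableEmbedding (he n).injective
  have hle {w : (∀ n, X n) → ℝ} (hw : w ∈ hedgeable ν) {m : ℝ} (hm : ∀ x, w x ≤ m) :
      l ⟨w, hw⟩ ≤ m :=
    (hl _).trans ((value_le hw (superhedges_of_le hm)).trans_eq (cost_zero m))
  let L : C(∀ n, Y n, ℝ) →ₗ[ℝ] ℝ :=
    { toFun u := l ⟨fun x => u (Pi.map e x), comp_mem_hedgeable u _⟩
      map_add' u v := l.map_add ⟨_, comp_mem_hedgeable u _⟩ ⟨_, comp_mem_hedgeable v _⟩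
      map_smul' c u := l.map_smul c ⟨_, comp_mem_hedgeable u _⟩ }
  have hL_le (u : C(∀ n, Y n, ℝ)) {m : ℝ} (hm : ∀ y, u y ≤ m) : L u ≤ m :=
    hle _ fun x => hm _
  have hL_nonneg (u : C(∀ n, Y n, ℝ)) (hu : ∀ y, 0 ≤ u y) : 0 ≤ L u := by
    have := hL_le (-u) (m := 0) fun y => by simpa using hu y
    rw [map_neg] at this
    linarith
  obtain ⟨ρ, hρ, hρL⟩ := exists_measure_integral_eq L hL_nonneg
  have hρ1 : ρ Set.univ = 1 := by
    have h1 : L 1 ≤ 1 := hL_le 1 fun y => le_rfl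
    have h2 : L (-1) ≤ -1 := hL_le (-1) fun y => le_rfl
    rw [map_neg] at h2
    have h3 : ρ.real Set.univ = 1 := by
      have := hρL 1
      simp only [ContinuousMap.one_apply, integral_const, smul_eq_mul, mul_one] at this
      linarith
    exact (ENNReal.toReal_eq_one_iff _).1 h3
  have hmarg (n : ι) : ρ.map (fun y => y n) = (ν n).map (e n) := by
    have hle' (u : C(Y n, ℝ)) :
        ∫ y, u y ∂(ρ.map fun y => y n) ≤ ∫ y, u y ∂((ν n).map (e n)) := by
      have h1 : ∫ y, u y ∂(ρ.map fun y => y n) = ∫ y : ∀ n, Y n, u (y n) ∂ρ :=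
        integral_map (measurable_pi_apply n).aemeasurable u.continuous.aestronglyMeasurable
      have h2 : ∫ y : ∀ n, Y n, u (y n) ∂ρ =
          L (u.comp ⟨fun y : ∀ n, Y n => y n, continuous_apply n⟩) :=
        hρL (u.comp ⟨fun y : ∀ n, Y n => y n, continuous_apply n⟩)
      rw [(hen n).integral_map, h1, h2]
      have h3 : value ν (fun x => u (e n (x n))) ≤ ∫ y, u (e n y) ∂(ν n) :=
        value_eval_le n (v := fun y => u (e n y))
          (u.continuous.measurable.comp (hen n).measurable) fun y => u.norm_coe_le_norm (e n y)
      exact (hl _).trans h3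
    have hfin : IsFiniteMeasure (ρ.map fun y => y n) := inferInstance
    have hfin' : IsFiniteMeasure ((ν n).map (e n)) := inferInstance
    refine ext_of_forall_integral_eq_of_IsFiniteMeasure fun u => le_antisymm (hle' u) ?_
    -- Domination is one-sided; applying it to `-u` yields equality.
    have h1 : ∫ y, -u y ∂(ρ.map fun y => y n) ≤ ∫ y, -u y ∂((ν n).map (e n)) :=
      hle' (-u.toContinuousMap)
    rw [integral_neg, integral_neg] at h1
    exact neg_le_neg_iff.1 h1
  obtain ⟨μ, hμ, hμρ⟩ := exists_coupling_map_eq he hρ1 hmarg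
  refine ⟨μ, hμ, fun u => ?_⟩
  rw [← hE.integral_map (fun y => u y), hμρ]
  exact hρL u

end Coupling

end CountableTransport

/-! ### The duality theorem. -/

open CountableTransport Filter Topology in
theorem mainTheorem5 {ι : Type*} [Countable ι] {X : ι → Type*}
    [∀ n, TopologicalSpace (X n)] [∀ n, PolishSpace (X n)]
    [∀ n, MeasurableSpace (X n)] [∀ n, BorelSpace (X n)]
    (ν : ∀ n, MeasureTheory.Measure (X n)) [∀ n, MeasureTheory.IsProbabilityMeasure (ν n)]
    (f : (∀ n, X n) → ℝ) (hfB : f ∈ CountableTransport.B ν)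
    (hfUG : (fun x => ((f x : ℝ) : EReal)) ∈ CountableTransport.UaddG ν) :
    (∀ μ ∈ CountableTransport.couplings ν, MeasureTheory.Integrable f μ) ∧
    IsGreatest
      ((fun μ : MeasureTheory.Measure (∀ n, X n) => ((∫ x, f x ∂μ : ℝ) : EReal)) ''
        CountableTransport.couplings ν)
      (CountableTransport.phi ν f) := by
  have hint : ∀ μ ∈ couplings ν, Integrable f μ := fun μ hμ => integrable_of_mem_B hμ hfB
  refine ⟨hint, ?_⟩
  suffices h : ∃ μ ∈ couplings ν, phi ν f ≤ ((∫ x, f x ∂μ : ℝ) : EReal) by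
    obtain ⟨μ, hμ, h⟩ := h
    refine ⟨⟨μ, hμ, (integral_le_phi hμ (hint μ hμ)).antisymm h⟩, ?_⟩
    rintro _ ⟨μ', hμ', rfl⟩
    exact integral_le_phi hμ' (hint μ' hμ')
  obtain ⟨h, ⟨husc, ⟨-, C, hC⟩, -⟩, F, ⟨g, hg, rfl⟩, hsum⟩ := hfUG
  -- As `f` is real-valued, `⊕g` is finite everywhere, so `h = f - ⊕g` is again hedgeable and `l`
  -- can be split.
  have hF (x : ∀ n, X n) : oplus g x ≠ ∞ := fun hx => by
    have := hsum x
    rw [hx, EReal.coe_ennreal_top, EReal.coe_add_top] at this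
    exact EReal.coe_ne_top _ this
  let G' : (∀ n, X n) → ℝ := fun x => (oplus g x).toReal
  have hfh : f = h + G' := by
    funext x
    have := hsum x
    rw [← EReal.coe_ennreal_toReal (hF x), ← EReal.coe_add] at this
    exact EReal.coe_eq_coe_iff.1 this
  have hsup : Superhedges ν G' 0 g :=
    ⟨hg, fun x => by rw [sub_zero, ENNReal.ofReal_toReal (hF x)]⟩
  have hG : G' ∈ hedgeable ν :=
    ⟨⟨_, _, hsup⟩, 0, 0, superhedges_of_le fun x => neg_nonpos.2 ENNReal.toReal_nonneg⟩
  have hf : f ∈ hedgeable ν := mem_hedgeable_of_mem_B hfB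
  have hh : h ∈ hedgeable ν := by
    rw [eq_sub_of_add_eq hfh.symm]
    exact sub_mem hf hG
  obtain ⟨l, hlf, hl⟩ := exists_linear_le_value hf
  let _ : ∀ n, MetricSpace (X n) := fun n => TopologicalSpace.metrizableSpaceMetric (X n)
  choose e he using fun n => Metric.PiNatEmbed.exists_embedding_to_hilbert_cube (X := X n)
  obtain ⟨μ, hμ, hμl⟩ := exists_coupling_of_linear_le_value he l hl
  have := hμ.1
  have : Nonempty (∀ n, X n) := nonempty_of_isProbabilityMeasure μ
  -- With `ι` possibly infinite there is no sup metric to use; any metric compatible with the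
  -- product topology will do.
  let _ : MetricSpace (ι → ℕ → unitInterval) :=
    TopologicalSpace.metrizableSpaceMetric (ι → ℕ → unitInterval)
  obtain ⟨H, hhH, hHC, hHlim⟩ := exists_continuous_approx_of_upperSemicontinuous
    (IsEmbedding.piMap he).isInducing husc fun x => (le_max_left _ _).trans (hC x)
  have hhint : Integrable h μ := by
    rw [eq_sub_of_add_eq hfh.symm]
    exact (hint μ hμ).sub (integrable_oplus hμ hg)
  refine ⟨μ, hμ, (phi_le_value hf).trans (EReal.coe_le_coe_iff.2 ?_)⟩
  have hlim : Tendsto (fun k => ∫ x, H k (Pi.map e x) ∂μ) atTop (𝓝 (∫ x, h x ∂μ)) := by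
    refine tendsto_integral_of_dominated_convergence (fun x => |h x| + |C|) (fun k => ?_)
      (hhint.abs.add (integrable_const _)) (fun k => Eventually.of_forall fun x => ?_)
      (Eventually.of_forall hHlim)
    · exact ((H k).continuous.comp
        (IsEmbedding.piMap he).continuous).aestronglyMeasurable
    · have h1 := hhH k x
      have h2 := hHC k (Pi.map e x)
      rw [Real.norm_eq_abs, abs_le]
      constructor <;> linarith [neg_abs_le (h x), le_abs_self C, abs_nonneg (h x), abs_nonneg C]
  -- The difference `h - H k` is nonpositive, so it is superhedged at cost `0`; hence `l h ≤ l (H k)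
  -- = ∫ H k ∂μ` for all `k`.
  have hlh : l ⟨h, hh⟩ ≤ ∫ x, h x ∂μ := by
    refine ge_of_tendsto' hlim fun k => ?_
    rw [hμl (H k), ← sub_nonpos, ← map_sub]
    refine (hl _).trans ?_
    refine (value_le (m := 0) (g := 0) (Subtype.prop _) (superhedges_of_le fun x => ?_)).trans_eq
      (cost_zero 0)
    exact sub_nonpos.2 (hhH k x)
  have hlG : l ⟨G', hG⟩ ≤ ∫ x, G' x ∂μ := by
    refine (hl _).trans ((value_le hG hsup).trans_eq ?_)
    rw [integral_oplus hμ hg, cost, zero_add]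
  have hadd : l ⟨f, hf⟩ = l ⟨h, hh⟩ + l ⟨G', hG⟩ := by
    rw [← map_add]
    exact congrArg l (Subtype.ext hfh)
  rw [← hlf, hadd, hfh]
  simp only [Pi.add_apply]
  rw [integral_add hhint (integrable_oplus hμ hg)]
  exact add_le_add hlh hlG
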